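/- Let $r,s\ge 0$ be integers with $r+s\ge 1$, and let $\mathbb R^{r,s}$ be $\mathbb R^{r+s}$ with the scalar product $\langle Z,W\rangle_{r,s}=\sum_{i=1}^r z_iw_i-\sum_{j=1}^s z_{r+j}w_{r+j}$. An admissible module of the Clifford algebra $\mathrm{Cl}(\mathbb R^{r,s})$ (with $Z^2=-\langle Z,Z\rangle_{r,s}$) is a nonzero finite-dimensional real representation $\mathfrak v$, $Z\mapsto J_Z$, together with a nondegenerate symmetric bilinear form $\langle\cdot,\cdot\rangle_{\mathfrak v}$ for which every $J_Z$, $Z\in\mathbb R^{r,s}$, is skew-symmetric; it is minimal if $\dim\mathfrak v$ is the least possible among all admissible modules of $\mathrm{Cl}(\mathbb R^{r,s})$. Let $\mathfrak v$ be a minimal admissible module of $\mathrm{Cl}(\mathbb R^{r,s})$; if $(r,s)=(0,1)$, any admissible module is allowed. Let $\mathfrak n_{r,s}=\mathfrak z\oplus\mathfrak v$, $\mathfrak z=\mathbb R^{r,s}$, be the pseudo $H$-type Lie algebra with orthogonal direct sum scalar product $\langle\cdot,\cdot\rangle$, centre $\mathfrak z$ and bracket $[\mathfrak v,\mathfrak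 v]\subseteq\mathfrak z$ given by $\langle [X,Y],Z\rangle_{r,s}=\langle J_ZX,Y\rangle_{\mathfrak v}$. Let $N_{r,s}$ be the connected simply connected Lie group with Lie algebra $\mathfrak n_{r,s}$ and the left-invariant pseudo-Riemannian metric generated by $\langle\cdot,\cdot\rangle$. Let $H$ be the group of isometric automorphisms of $\mathfrak n_{r,s}$, with Lie algebra $\mathfrak h=\mathrm{Der}(\mathfrak n_{r,s})\cap\mathfrak{so}(\mathfrak n_{r,s})$, and let $G=N_{r,s}\rtimes H$ with Lie algebra $\mathfrak g=\mathfrak n_{r,s}\rtimes\mathfrak h$, so that $N_{r,s}=G/H$. We call $N_{r,s}$ naturally reductive if there is a reductive decomposition $\mathfrak g=\mathfrak h\oplus\mathfrak m$, i.e. $\mathrm{Ad}(H)\mathfrak m\subseteq\mathfrak m$, such that $$\langle[T,Q]_{\mathfrak m},R\rangle+\langle Q,[T,R]_{\mathfrak m}\rangle=0\qquad\text{for all }T,Q,R\in\mathfrak m,$$ where the subscript denotes the $\mathfrak m$-component along $\mathfrak h$ and $\langle\cdot,\cdot\rangle$ is the scalar product on $\mathfrak m\cong T_{eH}(G/H)=\mathfrak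 n_{r,s}$ given by the metric. Then $N_{r,s}$ is naturally reductive if and only if $(r,s)\in\{(1,0),(0,1),(3,0),(1,2)\}$. -/

import Mathlib

noncomputable section

universe u

/-- The scalar product `⟨Z, W⟩_{r,s} = ∑_{i ≤ r} zᵢ wᵢ - ∑_{j ≤ s} z_{r+j} w_{r+j}` of the
pseudo-Euclidean space `ℝ^{r,s}`; the first `r` coordinates are indexed by `Fin r`, the last `s`
by `Fin s`. -/
def centerForm (r s : ℕ) : LinearMap.BilinForm ℝ (Fin r ⊕ Fin s → ℝ) :=
  LinearMap.mk₂ ℝ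
    (fun Z W => ∑ i, Z (Sum.inl i) * W (Sum.inl i) - ∑ j, Z (Sum.inr j) * W (Sum.inr j))
    (fun Z Z' W => by simp only [Pi.add_apply, add_mul, Finset.sum_add_distrib]; ring)
    (fun c Z W => by
      simp only [Pi.smul_apply, smul_eq_mul, mul_assoc, ← Finset.mul_sum]; ring)
    (fun Z W W' => by simp only [Pi.add_apply, mul_add, Finset.sum_add_distrib]; ring)
    (fun c Z W => by
      simp only [Pi.smul_apply, smul_eq_mul, mul_left_comm _ c, ← Finset.mul_sum]; ring)

theorem centerForm_apply {r s : ℕ} (Z W : Fin r ⊕ Fin s → ℝ) :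
    centerForm r s Z W =
      ∑ i, Z (Sum.inl i) * W (Sum.inl i) - ∑ j, Z (Sum.inr j) * W (Sum.inr j) := rfl

/-- The quadratic form `Z ↦ -⟨Z, Z⟩_{r,s}`. Its Clifford algebra is `Cl(ℝ^{r,s})` with the
convention `Z² = -⟨Z, Z⟩_{r,s}`. -/
def cliffordForm (r s : ℕ) : QuadraticForm ℝ (Fin r ⊕ Fin s → ℝ) :=
  -(LinearMap.BilinMap.toQuadraticMap (centerForm r s))

/-- An admissible module of `Cl(ℝ^{r,s})`: a representation of the Clifford algebra on `V` with
a scalar product (a nondegenerate symmetric bilinear form, of any signature) on `V` for which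
every `J_Z`, `Z ∈ ℝ^{r,s}`, is skew-symmetric. -/
structure AdmissibleModule (r s : ℕ) (V : Type u) [AddCommGroup V] [Module ℝ V] where
  /-- the representation of the Clifford algebra -/
  rep : CliffordAlgebra (cliffordForm r s) →ₐ[ℝ] Module.End ℝ V
  /-- the scalar product -/
  form : LinearMap.BilinForm ℝ V
  form_symm : ∀ X Y, form X Y = form Y X
  form_nondegenerate : form.Nondegenerate
  form_skew : ∀ (Z : Fin r ⊕ Fin s → ℝ) (X Y : V),
    form (rep (CliffordAlgebra.ι (cliffordForm r s) Z) X) Y =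
      -form X (rep (CliffordAlgebra.ι (cliffordForm r s) Z) Y)

namespace AdmissibleModule

variable {r s : ℕ} {V : Type u} [AddCommGroup V] [Module ℝ V]

/-- The module is a minimal admissible module: its dimension is the least among all nonzero
finite-dimensional modules of the same Clifford algebra that carry an admissible scalar
product. -/
def IsMinimal (_ : AdmissibleModule r s V) : Prop :=
  ∀ (W : Type u) [AddCommGroup W] [Module ℝ W] [FiniteDimensional ℝ W] [Nontrivial W],
    AdmissibleModule r s W → Module.finrank ℝ V ≤ Module.finrank ℝ W

/-- The operators `J_Z`. -/
def J (M : AdmissibleModule r s V) : (Fin r ⊕ Fin s → ℝ) →ₗ[ℝ] Module.End ℝ V :=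
  M.rep.toLinearMap ∘ₗ CliffordAlgebra.ι (cliffordForm r s)

theorem form_J (M : AdmissibleModule r s V) (Z : Fin r ⊕ Fin s → ℝ) (X Y : V) :
    M.form (M.J Z X) Y = -M.form X (M.J Z Y) := M.form_skew Z X Y

theorem J_J (M : AdmissibleModule r s V) (Z : Fin r ⊕ Fin s → ℝ) (X : V) :
    M.J Z (M.J Z X) = -(centerForm r s Z Z) • X := by
  have h := congrArg M.rep (CliffordAlgebra.ι_sq_scalar (cliffordForm r s) Z)
  rw [map_mul, AlgHom.commutes] at h
  have h' := LinearMap.congr_fun h X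
  simp only [Module.End.mul_apply, Module.algebraMap_end_apply] at h'
  exact h'

/-- The commutator `V × V → ℝ^{r,s}`, in coordinates. It is the one determined by
`⟨J_Z X, Y⟩ = ⟨[X, Y], Z⟩_{r,s}`, see `centerForm_commutator`. -/
def commutator (M : AdmissibleModule r s V) (X Y : V) : Fin r ⊕ Fin s → ℝ :=
  Sum.elim (fun i => M.form (M.J (Pi.single (Sum.inl i) 1) X) Y)
    (fun j => -M.form (M.J (Pi.single (Sum.inr j) 1) X) Y)

theorem centerForm_commutator (M : AdmissibleModule r s V) (X Y : V)
    (Z : Fin r ⊕ Fin s → ℝ) :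
    centerForm r s (M.commutator X Y) Z = M.form (M.J Z X) Y := by
  have hZ : Z = ∑ k, Z k • (Pi.single k 1 : Fin r ⊕ Fin s → ℝ) := pi_eq_sum_univ' Z
  have h : M.form (M.J Z X) Y =
      ∑ k, Z k * M.form (M.J (Pi.single k 1 : Fin r ⊕ Fin s → ℝ) X) Y := by
    conv_lhs => rw [hZ, map_sum]
    simp only [map_smul, LinearMap.sum_apply, LinearMap.smul_apply, map_sum, smul_eq_mul]
  rw [h, Fintype.sum_sum_type, centerForm_apply]
  simp [commutator, mul_comm]

/-- The pseudo `H`-type Lie algebra `𝔫_{r,s} = 𝔷 ⊕ 𝔳`, `𝔷 = ℝ^{r,s}`, `𝔳 = V`. -/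
@[ext] structure LieAlg (M : AdmissibleModule r s V) where
  /-- the `𝔷`-component -/
  z : Fin r ⊕ Fin s → ℝ
  /-- the `𝔳`-component -/
  v : V

namespace LieAlg

variable (M : AdmissibleModule r s V)

/-- `𝔫 = 𝔷 × 𝔳` as a set. -/
def toProd : M.LieAlg ≃ (Fin r ⊕ Fin s → ℝ) × V where
  toFun x := (x.z, x.v)
  invFun p := ⟨p.1, p.2⟩
  left_inv _ := rfl
  right_inv _ := rfl

instance : AddCommGroup M.LieAlg := (toProd M).addCommGroup

instance : Module ℝ M.LieAlg := (toProd M).module ℝ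

instance : Bracket M.LieAlg M.LieAlg where
  bracket x y := ⟨M.commutator x.v y.v, 0⟩

variable {M}

@[simp] theorem zero_z : (0 : M.LieAlg).z = 0 := rfl
@[simp] theorem zero_v : (0 : M.LieAlg).v = 0 := rfl
@[simp] theorem add_z (x y : M.LieAlg) : (x + y).z = x.z + y.z := rfl
@[simp] theorem add_v (x y : M.LieAlg) : (x + y).v = x.v + y.v := rfl
@[simp] theorem smul_z (c : ℝ) (x : M.LieAlg) : (c • x).z = c • x.z := rfl
@[simp] theorem smul_v (c : ℝ) (x : M.LieAlg) : (c • x).v = c • x.v := rfl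
@[simp] theorem lie_z (x y : M.LieAlg) : ⁅x, y⁆.z = M.commutator x.v y.v := rfl
@[simp] theorem lie_v (x y : M.LieAlg) : ⁅x, y⁆.v = 0 := rfl

instance : LieRing M.LieAlg where
  add_lie x y w := by
    ext k
    · cases k <;> simp [commutator]
      ring
    · simp
  lie_add x y w := by
    ext k
    · cases k <;> simp [commutator]
      ring
    · simp
  lie_self x := by
    have h : ∀ Z, M.form (M.J Z x.v) x.v = 0 := fun Z => by
      have h1 := M.form_J Z x.v x.v
      rw [M.form_symm x.v] at h1
      linarith
    ext k
    · cases k <;> simp [commutator, h]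
    · simp
  leibniz_lie x y w := by
    ext k
    · cases k <;> simp [commutator]
    · simp

instance : LieAlgebra ℝ M.LieAlg where
  lie_smul c x y := by
    ext k
    · cases k <;> simp [commutator]
    · simp

variable (M) in
/-- The scalar product on `𝔫 = T_e N`, the orthogonal sum of those on `𝔷` and `𝔳`. It generates
the left-invariant metric of `N_{r,s}`. -/
def form : LinearMap.BilinForm ℝ M.LieAlg :=
  LinearMap.mk₂ ℝ (fun x y => centerForm r s x.z y.z + M.form x.v y.v)
    (fun x x' y => by simp only [add_z, add_v, map_add, LinearMap.add_apply]; ring)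
    (fun c x y => by
      simp only [smul_z, smul_v, map_smul, LinearMap.smul_apply, smul_eq_mul]; ring)
    (fun x y y' => by simp only [add_z, add_v, map_add]; ring)
    (fun c x y => by simp only [smul_z, smul_v, map_smul, smul_eq_mul]; ring)

theorem form_apply (x y : M.LieAlg) :
    form M x y = centerForm r s x.z y.z + M.form x.v y.v := rfl

end LieAlg

/-- The isotropy group `H` of `N_{r,s}`: the isometric automorphisms of `𝔫` (equivalently, of the
connected simply connected group `N_{r,s}` with its left-invariant metric). -/
def isotropyGroup (M : AdmissibleModule r s V) : Subgroup (M.LieAlg ≃ₗ[ℝ] M.LieAlg) where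
  carrier := {a | (∀ x y, a ⁅x, y⁆ = ⁅a x, a y⁆) ∧
    ∀ x y, LieAlg.form M (a x) (a y) = LieAlg.form M x y}
  mul_mem' := by
    rintro a b ⟨ha, ha'⟩ ⟨hb, hb'⟩
    exact ⟨fun x y => by simp [ha, hb], fun x y => by simp [ha', hb']⟩
  one_mem' := ⟨fun _ _ => rfl, fun _ _ => rfl⟩
  inv_mem' := by
    rintro a ⟨ha, ha'⟩
    have h : ∀ x, a (a⁻¹ x) = x := fun x => a.apply_symm_apply x
    refine ⟨fun x y => a.injective ?_, fun x y => ?_⟩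
    · rw [ha, h, h, h]
    · rw [← ha', h, h]

/-- The Lie algebra `𝔥 = Der(𝔫) ∩ 𝔰𝔬(𝔫)` of `H`: the skew-symmetric derivations of `𝔫`. -/
def isotropyAlg (M : AdmissibleModule r s V) :
    LieSubalgebra ℝ (LieDerivation ℝ M.LieAlg M.LieAlg) where
  carrier := {D | ∀ x y, LieAlg.form M (D x) y = -LieAlg.form M x (D y)}
  add_mem' := by
    intro D D' h h' x y
    simp only [LieDerivation.add_apply, map_add, LinearMap.add_apply, h x y, h' x y]
    ring
  zero_mem' := by intro x y; simp
  smul_mem' := by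
    intro c D h x y
    simp only [LieDerivation.smul_apply, map_smul, LinearMap.smul_apply, smul_eq_mul, h x y]
    ring
  lie_mem' := by
    intro D D' h h' x y
    have h : ∀ x y, LieAlg.form M (D x) y = -LieAlg.form M x (D y) := h
    have h' : ∀ x y, LieAlg.form M (D' x) y = -LieAlg.form M x (D' y) := h'
    simp only [LieDerivation.commutator_apply, map_sub, LinearMap.sub_apply, h, h', neg_neg]
    ring

/-- The Lie algebra `𝔤 = 𝔫 ⋊ 𝔥` of the group of isometries `G = N_{r,s} ⋊ H`, acting transitively
on `N_{r,s} = G / H`. -/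
abbrev IsometryAlg (M : AdmissibleModule r s V) : Type u :=
  LieAlgebra.SemiDirectSum M.LieAlg M.isotropyAlg M.isotropyAlg.incl

/-- `D ↦ a D a⁻¹` for an isometric automorphism `a` and a skew-symmetric derivation `D`. -/
def conj (M : AdmissibleModule r s V) (a : M.isotropyGroup) (D : M.isotropyAlg) :
    M.isotropyAlg :=
  ⟨{ toLinearMap := a.1.toLinearMap ∘ₗ D.1.toLinearMap ∘ₗ a.1.symm.toLinearMap
     leibniz' := fun x y => by
      have h1 : a.1.symm ⁅x, y⁆ = ⁅a.1.symm x, a.1.symm y⁆ :=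
        ((M.isotropyGroup).inv_mem a.2).1 x y
      have h2 := a.2.1
      simp only [LinearMap.comp_apply, LinearEquiv.coe_coe, h1, LieDerivation.coeFn_coe,
        LieDerivation.apply_lie_eq_sub, map_sub, h2, LinearEquiv.apply_symm_apply] },
    fun x y => by
      have h1 : ∀ u w, LieAlg.form M (a.1 u) w = LieAlg.form M u (a.1.symm w) := fun u w => by
        rw [← a.2.2 u, LinearEquiv.apply_symm_apply]
      have h2 : ∀ u w, LieAlg.form M u (a.1 w) = LieAlg.form M (a.1.symm u) w := fun u w => by
        rw [← a.2.2 _ w, LinearEquiv.apply_symm_apply]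
      change LieAlg.form M (a.1 (D.1 (a.1.symm x))) y
        = -LieAlg.form M x (a.1 (D.1 (a.1.symm y)))
      rw [h1, h2]
      exact D.2 _ _⟩

theorem conj_apply (M : AdmissibleModule r s V) (a : M.isotropyGroup) (D : M.isotropyAlg)
    (x : M.LieAlg) : (M.conj a D).1 x = a.1 (D.1 (a.1.symm x)) := rfl

/-- The adjoint action of `a ∈ H ⊆ G` on `𝔤 = 𝔫 ⋊ 𝔥`: `Ad(a)(x, D) = (a x, a D a⁻¹)`. -/
def Ad (M : AdmissibleModule r s V) (a : M.isotropyGroup) (T : M.IsometryAlg) :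
    M.IsometryAlg := ⟨a.1 T.left, M.conj a T.right⟩

/-- The subalgebra `𝔥 ⊆ 𝔤`, the Lie algebra of the isotropy group of `e`. -/
def isotropySubspace (M : AdmissibleModule r s V) : Submodule ℝ M.IsometryAlg :=
  LinearMap.range
    (LieAlgebra.SemiDirectSum.inr M.isotropyAlg.incl : M.isotropyAlg →ₗ[ℝ] M.IsometryAlg)

/-- The scalar product of the metric at `e`, pulled back to `𝔤` by the differential
`𝔤 → T_e N = 𝔫`, `(x, D) ↦ x`, of the orbit map `G → N`, `g ↦ g(e)`. On a complement `𝔪` of `𝔥`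
it is the scalar product of `𝔪 = T_e (G / H)` defined by the metric. -/
def tangentForm (M : AdmissibleModule r s V) : LinearMap.BilinForm ℝ M.IsometryAlg :=
  (LieAlg.form M).compl₁₂ (LieAlgebra.SemiDirectSum.projl M.isotropyAlg.incl)
    (LieAlgebra.SemiDirectSum.projl M.isotropyAlg.incl)

/-- The pseudo `H`-type nilmanifold `N_{r,s} = G / H`, `G = N_{r,s} ⋊ H`, is naturally reductive:
there is a reductive decomposition `𝔤 = 𝔥 ⊕ 𝔪` (the complement `𝔪` is `Ad(H)`-invariant) with
`⟨[T, Q]_𝔪, R⟩ + ⟨Q, [T, R]_𝔪⟩ = 0` for all `T, Q, R ∈ 𝔪`. -/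
def IsNaturallyReductive (M : AdmissibleModule r s V) : Prop :=
  ∃ (m : Submodule ℝ M.IsometryAlg) (hm : IsCompl m M.isotropySubspace),
    (∀ (a : M.isotropyGroup), ∀ T ∈ m, M.Ad a T ∈ m) ∧
    ∀ T ∈ m, ∀ Q ∈ m, ∀ R ∈ m,
      M.tangentForm (m.projection _ hm ⁅T, Q⁆) R + M.tangentForm Q (m.projection _ hm ⁅T, R⁆) = 0

end AdmissibleModule

end

-- The geometry reduces to algebra: `N_{r,s}` is naturally reductive exactly when the operators
-- `J_Z` are closed under commutators (`IsLieClosed`).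
--
-- If `(Z, D)` lies in a naturally reductive complement, testing the condition on lifts of `X, Y ∈
-- 𝔳` forces `D = J_Z` on `𝔳`. A skew derivation of this kind satisfies `[J_Z, J_W] = J_{DW}`.
-- Conversely, if commutators close up, `J` pulls them back to a Lie bracket `A` on `𝔷` with `A Z`
-- skew. Then `φ(Z) = (A Z, J_Z)` is a skew derivation, and the graph of `(Z, X) ↦ φ(Z)` is the
-- required complement.
--
-- Closure is then a question about Clifford algebras. For orthonormal `e_a, e_b` it says that `J_a
-- J_b` is some `J_U`. The Clifford relations force `U` to be a multiple of a third basis vector,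
-- which must be the only one left, and squaring gives `ε_a ε_b ε_c > 0`. So the rank is 1, or it is
-- 3 with `s` even. Conversely, in rank 3 with `s` even the volume element `J_a J_b J_c` is a
-- central self-adjoint involution. Minimality makes it `±1`, hence `J_a J_b = ±J_c`.

universe u

/-! ### Signs of the centre and Clifford relations -/

/-- The sign `⟨e_k, e_k⟩_{r,s}` of the `k`-th standard basis vector of `ℝ^{r,s}`. -/
def centerSign {r s : ℕ} (k : Fin r ⊕ Fin s) : ℝ := Sum.elim (fun _ => 1) (fun _ => -1) k

theorem centerSign_mul_self {r s : ℕ} (k : Fin r ⊕ Fin s) : centerSign k * centerSign k = 1 := by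
  cases k <;> simp [centerSign]

theorem centerForm_symm {r s : ℕ} (Z W : Fin r ⊕ Fin s → ℝ) :
    centerForm r s Z W = centerForm r s W Z := by
  simp only [centerForm_apply, mul_comm]

theorem centerForm_single {r s : ℕ} (Z : Fin r ⊕ Fin s → ℝ) (k : Fin r ⊕ Fin s) :
    centerForm r s Z (Pi.single k 1) = centerSign k * Z k := by
  cases k <;> simp [centerForm_apply, centerSign, Pi.single_apply]

theorem eq_zero_of_centerForm {r s : ℕ} {Z : Fin r ⊕ Fin s → ℝ}
    (h : ∀ W, centerForm r s Z W = 0) : Z = 0 := by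
  funext k
  have h1 := h (Pi.single k 1)
  rw [centerForm_single] at h1
  have h2 := centerSign_mul_self k
  have h3 : centerSign k ≠ 0 := fun h => by simp [h] at h2
  simpa [h3] using h1

namespace AdmissibleModule

variable {r s : ℕ} {V : Type u} [AddCommGroup V] [Module ℝ V] (M : AdmissibleModule r s V)

theorem J_mul_self (Z : Fin r ⊕ Fin s → ℝ) :
    M.J Z * M.J Z = -(centerForm r s Z Z) • (1 : Module.End ℝ V) := by
  ext X
  simpa using M.J_J Z X

theorem J_mul_add_J_mul (Z W : Fin r ⊕ Fin s → ℝ) :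
    M.J Z * M.J W + M.J W * M.J Z = -(2 * centerForm r s Z W) • (1 : Module.End ℝ V) := by
  have h := M.J_mul_self (Z + W)
  have e : M.J Z * M.J W + M.J W * M.J Z =
      M.J (Z + W) * M.J (Z + W) - M.J Z * M.J Z - M.J W * M.J W := by
    rw [map_add]; noncomm_ring
  rw [e, h, M.J_mul_self Z, M.J_mul_self W, ← sub_smul, ← sub_smul]
  congr 1
  simp only [map_add, LinearMap.add_apply, centerForm_symm W Z]
  ring

theorem eq_zero_of_form {X : V} (h : ∀ Y, M.form X Y = 0) : X = 0 :=
  M.form_nondegenerate.1 X h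

theorem eq_zero_of_J_single {k : Fin r ⊕ Fin s} {X : V} (h : M.J (Pi.single k 1) X = 0) :
    X = 0 := by
  have h1 := M.J_J (Pi.single k 1) X
  have h2 := centerSign_mul_self k
  have h3 : centerSign k ≠ 0 := fun h => by simp [h] at h2
  rw [h, map_zero, centerForm_single] at h1
  simpa [h3] using h1.symm

/-- The anticommutator of `J_Z` and `J_W` recovers the nondegenerate form `⟨Z, W⟩`. -/
theorem J_injective [Nontrivial V] : Function.Injective M.J := by
  rw [injective_iff_map_eq_zero]
  intro Z hZ
  refine eq_zero_of_centerForm fun W => ?_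
  have h := M.J_mul_add_J_mul Z W
  rw [hZ] at h
  simpa using h.symm

theorem form_commutator (X Y : V) (Z : Fin r ⊕ Fin s → ℝ) :
    centerForm r s Z (M.commutator X Y) = M.form (M.J Z X) Y := by
  rw [centerForm_symm, centerForm_commutator]

/-- The operators `J_Z` form a Lie subalgebra of `End V`. -/
def IsLieClosed : Prop := ∀ Z W, (M.J Z * M.J W - M.J W * M.J Z) ∈ LinearMap.range M.J

namespace LieAlg

variable {M}

@[simp] theorem sub_z (x y : M.LieAlg) : (x - y).z = x.z - y.z := rfl
@[simp] theorem sub_v (x y : M.LieAlg) : (x - y).v = x.v - y.v := rfl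

end LieAlg

/-! ### Complements of `𝔥` and skew derivations -/

theorem exists_mem_left (m : Submodule ℝ M.IsometryAlg) (hm : IsCompl m M.isotropySubspace)
    (x : M.LieAlg) : ∃ D : M.isotropyAlg, (⟨x, D⟩ : M.IsometryAlg) ∈ m := by
  have h : (⟨x, 0⟩ : M.IsometryAlg) ∈ m ⊔ M.isotropySubspace := by
    rw [hm.sup_eq_top]; trivial
  obtain ⟨T, hT, _, ⟨D, rfl⟩, h⟩ := Submodule.mem_sup.1 h
  refine ⟨T.right, ?_⟩
  have : T.left = x := by simpa using congrArg LieAlgebra.SemiDirectSum.left h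
  rwa [← this]

/-- Elements of `𝔥` have no `𝔫`-component, so `tangentForm` does not see the projection to `𝔪`. -/
theorem projection_left (m : Submodule ℝ M.IsometryAlg) (hm : IsCompl m M.isotropySubspace)
    (T : M.IsometryAlg) : (m.projection _ hm T).left = T.left := by
  obtain ⟨D, hD⟩ := Submodule.sub_projection_mem hm T
  have := congrArg LieAlgebra.SemiDirectSum.left hD
  simp only [LieAlgebra.SemiDirectSum.sub_eq_mk] at this
  exact (sub_eq_zero.1 this.symm).symm

theorem tangentForm_apply (T Q : M.IsometryAlg) :
    M.tangentForm T Q = LieAlg.form M T.left Q.left := rfl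

/-- If a skew-symmetric derivation acts on `V` as `J_Z`, then its action on the centre
corresponds to the commutator with `J_Z`. -/
theorem lie_J_of_isotropyAlg (D : M.isotropyAlg) (Z W : Fin r ⊕ Fin s → ℝ)
    (hD : ∀ X, (D.1 ⟨0, X⟩).v = M.J Z X) : M.J Z * M.J W - M.J W * M.J Z = M.J (D.1 ⟨W, 0⟩).z := by
  ext X
  rw [← sub_eq_zero]
  refine M.eq_zero_of_form fun Y => ?_
  have h := D.1.apply_lie_eq_sub ⟨0, X⟩ ⟨0, Y⟩
  -- Skewness moves `D` from `[X, Y]` to `W`; the derivation rule then turns both sides into forms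
  -- on `V`.
  have h1 := D.2 ⁅(⟨0, X⟩ : M.LieAlg), (⟨0, Y⟩ : M.LieAlg)⁆ ⟨W, 0⟩
  have h2 : (⁅(⟨0, X⟩ : M.LieAlg), (⟨0, Y⟩ : M.LieAlg)⁆).v = 0 := rfl
  rw [h] at h1
  simp only [LieAlg.form_apply, LieAlg.lie_z, map_sub, LinearMap.sub_apply,
    centerForm_commutator, map_zero, hD, h2, LinearMap.zero_apply] at h1
  have h3 := M.form_J Z (M.J W X) Y
  have h4 := M.form_J W Y (M.J Z X)
  have h5 := M.form_symm (M.J W Y) (M.J Z X)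
  have h6 := M.form_symm (M.J W (M.J Z X)) Y
  simp only [LinearMap.sub_apply, Module.End.mul_apply, map_sub, h3]
  linarith

/-! ### Natural reductivity forces closure under commutators -/

section Necessity

variable [Nonempty (Fin r ⊕ Fin s)]

/-- Applying `D` to `[Z, Y] = 0` gives `[DZ, Y] = 0` for all `Y`, so an invertible `J_k` kills the
`𝔳`-part of `DZ`. -/
theorem LieAlg.derivation_center (D : LieDerivation ℝ M.LieAlg M.LieAlg)
    (Z : Fin r ⊕ Fin s → ℝ) : (D ⟨Z, 0⟩).v = 0 := by
  obtain ⟨k⟩ := ‹Nonempty (Fin r ⊕ Fin s)›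
  refine M.eq_zero_of_J_single (k := k) (M.eq_zero_of_form fun Y => ?_)
  have h0 : ⁅(⟨Z, 0⟩ : M.LieAlg), (⟨0, Y⟩ : M.LieAlg)⁆ = 0 := by
    ext i
    · cases i <;> simp [commutator]
    · simp
  have h := D.apply_lie_eq_sub ⟨Z, 0⟩ ⟨0, Y⟩
  rw [h0, map_zero] at h
  have h1 := congrArg (fun x => centerForm r s (LieAlg.z x) (Pi.single k 1)) h
  simp only [LieAlg.sub_z, LieAlg.lie_z, map_sub, LinearMap.sub_apply, centerForm_commutator, LieAlg.zero_z,
    map_zero, LinearMap.zero_apply] at h1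
  have h2 := M.form_J (Pi.single k 1) Y (D ⟨Z, 0⟩).v
  rw [M.form_symm Y] at h2
  simpa [h2] using h1.symm

theorem isotropyAlg_apply_v (D : M.isotropyAlg) (X : V) : (D.1 ⟨0, X⟩).z = 0 := by
  refine eq_zero_of_centerForm fun W => ?_
  have h := D.2 ⟨0, X⟩ ⟨W, 0⟩
  simpa [LieAlg.form_apply, LieAlg.derivation_center M D.1 W] using h

theorem IsNaturallyReductive.isLieClosed (h : M.IsNaturallyReductive) : M.IsLieClosed := by
  obtain ⟨m, hm, -, h⟩ := h
  intro Z W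
  obtain ⟨D, hD⟩ := M.exists_mem_left m hm ⟨Z, 0⟩
  refine ⟨_, (M.lie_J_of_isotropyAlg D Z W fun X => ?_).symm⟩
  rw [← sub_eq_zero]
  refine M.eq_zero_of_form fun Y => ?_
  obtain ⟨DX, hX⟩ := M.exists_mem_left m hm ⟨0, X⟩
  obtain ⟨DY, hY⟩ := M.exists_mem_left m hm ⟨0, Y⟩
  -- The derivations preserve `𝔷` and `𝔳`, so those lifting `X` and `Y` drop out, leaving `⟨J_Z X,
  -- Y⟩ = ⟨Y, D X⟩`.
  have h1 := h _ hX _ hY _ hD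
  simp only [tangentForm_apply, projection_left] at h1
  simp only [LieAlgebra.SemiDirectSum.lie_eq_mk, LieAlg.form_apply,
    LieAlg.lie_v,
    LieAlg.lie_z, map_add, LinearMap.add_apply, map_sub, LinearMap.sub_apply,
    centerForm_commutator, map_zero, LinearMap.zero_apply, LieSubalgebra.coe_incl,
    isotropyAlg_apply_v, LieAlg.derivation_center] at h1
  have h2 := M.form_symm Y (D.1 ⟨0, X⟩).v
  simp only [map_sub, LinearMap.sub_apply]
  simp at h1
  linarith

end Necessity

/-! ### Closure under commutators gives a naturally reductive complement -/

section Sufficiency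

variable {M}

/-- Injectivity of `J` makes the chosen preimages of commutators bilinear. -/
theorem IsLieClosed.exists_linearMap [Nontrivial V] (h : M.IsLieClosed) :
    ∃ A : (Fin r ⊕ Fin s → ℝ) →ₗ[ℝ] (Fin r ⊕ Fin s → ℝ) →ₗ[ℝ] (Fin r ⊕ Fin s → ℝ),
      ∀ Z W, M.J (A Z W) = M.J Z * M.J W - M.J W * M.J Z := by
  choose f hf using h
  exact ⟨LinearMap.mk₂ ℝ f
    (fun Z Z' W => M.J_injective (by simp only [hf, map_add]; noncomm_ring))
    (fun c Z W => M.J_injective (by simp only [hf, map_smul, smul_mul_assoc, mul_smul_comm, smul_sub]))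
    (fun Z W W' => M.J_injective (by simp only [hf, map_add]; noncomm_ring))
    (fun c Z W => M.J_injective (by simp only [hf, map_smul, smul_mul_assoc, mul_smul_comm, smul_sub])), hf⟩

/-- Since `J_W²` is scalar, a commutator with `J_W` anticommutes with `J_W`. -/
theorem centerForm_eq_zero_of_J_eq_lie [Nontrivial V] {U Z W : Fin r ⊕ Fin s → ℝ}
    (h : M.J U = M.J Z * M.J W - M.J W * M.J Z) : centerForm r s U W = 0 := by
  have h1 := M.J_mul_add_J_mul U W
  have e : M.J U * M.J W + M.J W * M.J U = M.J Z * (M.J W * M.J W) - M.J W * M.J W * M.J Z := by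
    rw [h]; noncomm_ring
  rw [e, M.J_mul_self W, mul_smul_comm, smul_mul_assoc, mul_one, one_mul, sub_self] at h1
  simpa using h1.symm

variable (A : (Fin r ⊕ Fin s → ℝ) →ₗ[ℝ] (Fin r ⊕ Fin s → ℝ) →ₗ[ℝ] (Fin r ⊕ Fin s → ℝ))

/-- Polarization of `⟨A Z W, W⟩ = 0`. -/
theorem centerForm_lie_swap [Nontrivial V] (hA : ∀ Z W, M.J (A Z W) = M.J Z * M.J W - M.J W * M.J Z)
    (Z U W : Fin r ⊕ Fin s → ℝ) :
    centerForm r s (A Z U) W = -centerForm r s U (A Z W) := by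
  have h1 := centerForm_eq_zero_of_J_eq_lie (hA Z (U + W))
  have h2 := centerForm_eq_zero_of_J_eq_lie (hA Z U)
  have h3 := centerForm_eq_zero_of_J_eq_lie (hA Z W)
  rw [centerForm_symm U]
  simp only [map_add, LinearMap.add_apply] at h1
  linarith

theorem lie_linearMap_swap [Nontrivial V] (hA : ∀ Z W, M.J (A Z W) = M.J Z * M.J W - M.J W * M.J Z)
    (Z W : Fin r ⊕ Fin s → ℝ) : A Z W = -A W Z :=
  M.J_injective (by rw [map_neg, hA, hA, neg_sub])

/-- The skew-symmetric derivation of `𝔫` acting as `J_Z` on `V`. -/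
def lieDerivation [Nontrivial V] (hA : ∀ Z W, M.J (A Z W) = M.J Z * M.J W - M.J W * M.J Z) :
    (Fin r ⊕ Fin s → ℝ) →ₗ[ℝ] M.isotropyAlg where
  toFun Z := ⟨{
      toFun := fun x => ⟨A Z x.z, M.J Z x.v⟩
      map_add' := fun x y => by ext <;> simp
      map_smul' := fun c x => by ext <;> simp
      leibniz' := fun x y => by
        ext1
        · rw [← sub_eq_zero]
          refine eq_zero_of_centerForm fun W => ?_
          have h1 := LinearMap.congr_fun (hA Z W) x.v
          have h2 := M.form_J W y.v (M.J Z x.v)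
          have h3 := M.form_symm (M.J W y.v) (M.J Z x.v)
          have h4 := M.form_symm y.v (M.J W (M.J Z x.v))
          have h5 := M.form_J Z (M.J W x.v) y.v
          simp only [LinearMap.coe_mk, AddHom.coe_mk, LieAlg.sub_z, LieAlg.lie_z, map_sub,
            LinearMap.sub_apply, centerForm_commutator, centerForm_lie_swap A hA,
            h1, LinearMap.sub_apply, Module.End.mul_apply]
          linarith
        · simp }, fun x y => by
      have h := M.form_J Z x.v y.v
      have h' := centerForm_lie_swap A hA Z x.z y.z
      change centerForm r s (A Z x.z) y.z + M.form (M.J Z x.v) y.v =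
        -(centerForm r s x.z (A Z y.z) + M.form x.v (M.J Z y.v))
      linarith⟩
  map_add' Z W := by
    ext x : 2
    change (⟨A (Z + W) x.z, M.J (Z + W) x.v⟩ : M.LieAlg) = ⟨A Z x.z, M.J Z x.v⟩ + ⟨A W x.z, M.J W x.v⟩
    ext1 <;> simp
  map_smul' c Z := by
    ext x : 2
    change (⟨A (c • Z) x.z, M.J (c • Z) x.v⟩ : M.LieAlg) = c • ⟨A Z x.z, M.J Z x.v⟩
    ext1 <;> simp

theorem lieDerivation_apply [Nontrivial V] (hA : ∀ Z W, M.J (A Z W) = M.J Z * M.J W - M.J W * M.J Z)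
    (Z : Fin r ⊕ Fin s → ℝ) (x : M.LieAlg) :
    (lieDerivation A hA Z).1 x = ⟨A Z x.z, M.J Z x.v⟩ := rfl

variable (M) in
theorem isotropyGroup_center [Nonempty (Fin r ⊕ Fin s)] (a : M.isotropyGroup)
    (Z : Fin r ⊕ Fin s → ℝ) : (a.1 ⟨Z, 0⟩).v = 0 := by
  obtain ⟨k⟩ := ‹Nonempty (Fin r ⊕ Fin s)›
  refine M.eq_zero_of_J_single (k := k) (M.eq_zero_of_form fun Y => ?_)
  have h0 : ⁅(⟨Z, 0⟩ : M.LieAlg), a.1.symm (⟨0, Y⟩ : M.LieAlg)⁆ = 0 := by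
    ext i
    · cases i <;> simp [commutator]
    · simp
  have h := a.2.1 ⟨Z, 0⟩ (a.1.symm ⟨0, Y⟩)
  rw [h0, map_zero, LinearEquiv.apply_symm_apply] at h
  have h1 := congrArg (fun x => centerForm r s (LieAlg.z x) (Pi.single k 1)) h
  simp only [LieAlg.lie_z, centerForm_commutator, LieAlg.zero_z, map_zero,
    LinearMap.zero_apply] at h1
  exact h1.symm

variable (M) in
theorem isotropyGroup_apply_v [Nonempty (Fin r ⊕ Fin s)] (a : M.isotropyGroup) (X : V) :
    (a.1 ⟨0, X⟩).z = 0 := by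
  refine eq_zero_of_centerForm fun W => ?_
  have h := a.2.2 ⟨0, X⟩ (a.1.symm ⟨W, 0⟩)
  have h1 := M.isotropyGroup_center a⁻¹ W
  have h2 : (a.1.symm ⟨W, 0⟩).v = 0 := h1
  rw [LinearEquiv.apply_symm_apply] at h
  simpa [LieAlg.form_apply, h2] using h

variable (M) in
theorem isotropyGroup_apply [Nonempty (Fin r ⊕ Fin s)] (a : M.isotropyGroup) (x : M.LieAlg) :
    (a.1 x).z = (a.1 ⟨x.z, 0⟩).z ∧ (a.1 x).v = (a.1 ⟨0, x.v⟩).v := by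
  have h : x = ⟨x.z, 0⟩ + ⟨0, x.v⟩ := by ext <;> simp
  constructor
  · conv_lhs => rw [h, map_add, LieAlg.add_z, isotropyGroup_apply_v, add_zero]
  · conv_lhs => rw [h, map_add, LieAlg.add_v, isotropyGroup_center, zero_add]

variable (M) in
/-- An isometric automorphism `a` of `𝔫` intertwines `J_Z` and `J_{aZ}`. -/
theorem isotropyGroup_apply_J [Nonempty (Fin r ⊕ Fin s)] (a : M.isotropyGroup)
    (Z : Fin r ⊕ Fin s → ℝ) (X : V) :
    (a.1 ⟨0, M.J Z X⟩).v = M.J (a.1 ⟨Z, 0⟩).z (a.1 ⟨0, X⟩).v := by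
  rw [← sub_eq_zero]
  refine M.eq_zero_of_form fun Y => ?_
  have hv := M.isotropyGroup_apply_v a⁻¹ Y
  replace hv : (a.1.symm ⟨0, Y⟩).z = 0 := hv
  have h1 := a.2.2 ⟨0, M.J Z X⟩ (a.1.symm ⟨0, Y⟩)
  have h2 := congrArg LieAlg.z (a.2.1 ⟨0, X⟩ (a.1.symm ⟨0, Y⟩))
  have h3 := a.2.2 ⁅(⟨0, X⟩ : M.LieAlg), a.1.symm ⟨0, Y⟩⁆ ⟨Z, 0⟩
  have h4 := M.isotropyGroup_center a Z
  rw [LinearEquiv.apply_symm_apply] at h1 h2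
  rw [LieAlg.form_apply, LieAlg.form_apply, h2, h4] at h3
  simp only [LieAlg.form_apply, LieAlg.lie_z, LieAlg.lie_v, centerForm_commutator, map_zero,
    hv, add_zero, zero_add] at h1 h3
  simp only [map_sub, LinearMap.sub_apply]
  linarith

theorem IsLieClosed.isNaturallyReductive [Nontrivial V] [Nonempty (Fin r ⊕ Fin s)]
    (h : M.IsLieClosed) : M.IsNaturallyReductive := by
  obtain ⟨A, hA⟩ := h.exists_linearMap
  let φ := lieDerivation A hA
  -- The graph of `x ↦ φ(x.z)`, the only candidate in view of the necessity argument.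
  let m : Submodule ℝ M.IsometryAlg :=
    { carrier := {T | T.right = φ T.left.z}
      add_mem' := fun {T Q} hT hQ => by
        change T.right + Q.right = φ (T.left.z + Q.left.z)
        rw [map_add, ← hT, ← hQ]
      zero_mem' := (map_zero φ).symm
      smul_mem' := fun c T hT => by
        change c • T.right = φ (c • T.left.z)
        rw [map_smul, ← hT] }
  have hmem : ∀ T : M.IsometryAlg, T ∈ m ↔ T.right = φ T.left.z := fun _ => Iff.rfl
  have hm : IsCompl m M.isotropySubspace := by
    refine IsCompl.of_eq ?_ ?_
    · rw [Submodule.eq_bot_iff]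
      rintro _ ⟨hT, D, rfl⟩
      have : D = φ 0 := hT
      rw [map_zero] at this
      rw [this, map_zero]
    · rw [Submodule.eq_top_iff']
      intro T
      refine Submodule.mem_sup.2 ⟨⟨T.left, φ T.left.z⟩, rfl, _, ⟨T.right - φ T.left.z, rfl⟩, ?_⟩
      simp
  refine ⟨m, hm, fun a T hT => ?_, fun T hT Q hQ R hR => ?_⟩
  -- `Ad(H)`-invariance amounts to `a φ(Z) a⁻¹ = φ(aZ)`; on both components it follows from `a J_Z =
  -- J_{aZ} a`.
  · rw [hmem] at hT ⊢
    change M.conj a T.right = φ (a.1 T.left).z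
    rw [hT]
    ext x : 2
    rw [conj_apply, lieDerivation_apply, lieDerivation_apply, (M.isotropyGroup_apply a T.left).1]
    have hx : x = a.1 (a.1.symm x) := (a.1.apply_symm_apply x).symm
    generalize a.1.symm x = y at hx
    subst hx
    ext1
    · apply M.J_injective
      ext X
      obtain ⟨X, rfl⟩ : ∃ X₀, X = (a.1 ⟨0, X₀⟩).v :=
        ⟨(a.1.symm ⟨0, X⟩).v, by rw [← (M.isotropyGroup_apply a _).2, a.1.apply_symm_apply]⟩
      have hsub : ∀ X Y : V, (⟨0, X - Y⟩ : M.LieAlg) = ⟨0, X⟩ - ⟨0, Y⟩ := fun X Y => by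
        ext <;> simp
      rw [(M.isotropyGroup_apply a _).1, (M.isotropyGroup_apply a y).1, ← isotropyGroup_apply_J,
        hA, hA, LinearMap.sub_apply, LinearMap.sub_apply, hsub, map_sub, LieAlg.sub_v]
      simp only [Module.End.mul_apply, isotropyGroup_apply_J]
    · rw [(M.isotropyGroup_apply a _).2, (M.isotropyGroup_apply a y).2]
      exact M.isotropyGroup_apply_J a _ _
  -- On the centre `A T Q - A Q T = 2 A T Q`, which is skew in `Q, R`; the `𝔳`-terms cancel by
  -- skewness of `J`.
  · rw [hmem] at hT hQ hR
    simp only [tangentForm_apply, projection_left, LieAlgebra.SemiDirectSum.lie_eq_mk, hT, hQ, hR,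
      LieSubalgebra.coe_incl, LieAlg.form_apply, LieAlg.lie_z, LieAlg.lie_v, φ, lieDerivation_apply, map_sub, map_add,
      LinearMap.sub_apply, LinearMap.add_apply, centerForm_commutator, form_commutator]
    have h1 := M.form_J T.left.z Q.left.v R.left.v
    have h2 := M.form_symm Q.left.v (M.J R.left.z T.left.v)
    have h3 := centerForm_lie_swap A hA T.left.z Q.left.z R.left.z
    rw [lie_linearMap_swap A hA Q.left.z, lie_linearMap_swap A hA R.left.z]
    simp only [map_neg, LinearMap.neg_apply, map_zero, LinearMap.zero_apply]
    linarith

end Sufficiency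
-- Which ranks and signatures allow closure
theorem J_single_mul_self (k : Fin r ⊕ Fin s) :
    M.J (Pi.single k 1) * M.J (Pi.single k 1) = -centerSign k • (1 : Module.End ℝ V) := by
  rw [J_mul_self, centerForm_single, Pi.single_eq_same, mul_one]

theorem J_single_mul_comm {k l : Fin r ⊕ Fin s} (h : k ≠ l) :
    M.J (Pi.single l 1) * M.J (Pi.single k 1) = -(M.J (Pi.single k 1) * M.J (Pi.single l 1)) := by
  have h1 := M.J_mul_add_J_mul (Pi.single k 1) (Pi.single l 1)
  rw [centerForm_single, Pi.single_eq_of_ne h.symm, mul_zero, mul_zero, neg_zero, zero_smul] at h1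
  exact eq_neg_of_add_eq_zero_right h1

theorem centerSign_ne_zero (k : Fin r ⊕ Fin s) : (centerSign k : ℝ) ≠ 0 := fun h => by
  simpa [h] using centerSign_mul_self k

/-- If the operators `J_Z` form a Lie algebra of rank at least two, then the rank is three and the
product of the signs of an orthonormal basis is positive. -/
theorem IsLieClosed.exists_third [Nontrivial V] {M : AdmissibleModule r s V} (h : M.IsLieClosed)
    {a b : Fin r ⊕ Fin s} (hab : a ≠ b) :
    ∃ c, c ≠ a ∧ c ≠ b ∧ (∀ d, d = a ∨ d = b ∨ d = c) ∧
      0 < (centerSign a * centerSign b * centerSign c : ℝ) := by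
  obtain ⟨U, hU⟩ := h (Pi.single a 1) (Pi.single b 1)
  set A := M.J (Pi.single a 1)
  set B := M.J (Pi.single b 1)
  have hA : A * A = _ := M.J_single_mul_self a
  have hB : B * B = _ := M.J_single_mul_self b
  have hBA : B * A = -(A * B) := M.J_single_mul_comm hab
  have hU : M.J U = (2 : ℝ) • (A * B) := by rw [hU, hBA, two_smul]; abel
  have hAAB : A * (A * B) = -centerSign a • B := by rw [← mul_assoc, hA]; simp
  have hABA : (A * B) * A = centerSign a • B := by rw [mul_assoc, hBA, mul_neg, hAAB]; simp
  have hBAB : B * (A * B) = centerSign b • A := by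
    rw [← mul_assoc, hBA, neg_mul, mul_assoc, hB]; simp
  have hABB : (A * B) * B = -centerSign b • A := by rw [mul_assoc, hB]; simp
  have hUa : U a = 0 := by
    have h1 := M.J_mul_add_J_mul U (Pi.single a 1)
    change M.J U * A + A * M.J U = _ at h1
    rw [hU, smul_mul_assoc, mul_smul_comm, hAAB, hABA, centerForm_single] at h1
    simpa [centerSign_ne_zero] using h1
  have hUb : U b = 0 := by
    have h1 := M.J_mul_add_J_mul U (Pi.single b 1)
    change M.J U * B + B * M.J U = _ at h1
    rw [hU, smul_mul_assoc, mul_smul_comm, hBAB, hABB, centerForm_single] at h1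
    simpa [centerSign_ne_zero] using h1
  -- `J_c` anticommutes with both `A` and `B`, hence commutes with `J_U`. The Clifford relation then
  -- makes `J_U J_c` scalar, so `J_U` is a multiple of `J_c`.
  have hUc : ∀ c, c ≠ a → c ≠ b → U = U c • Pi.single c 1 := by
    intro c hca hcb
    apply M.J_injective
    have h1 := M.J_mul_add_J_mul U (Pi.single c 1)
    have hCA : M.J (Pi.single c 1) * A = -(A * _) := M.J_single_mul_comm hca.symm
    have hCB : M.J (Pi.single c 1) * B = -(B * _) := M.J_single_mul_comm hcb.symm
    have hCC := M.J_single_mul_self c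
    have e : M.J (Pi.single c 1) * M.J U = M.J U * M.J (Pi.single c 1) := by
      rw [hU, mul_smul_comm, smul_mul_assoc, ← mul_assoc, hCA, neg_mul, mul_assoc, hCB, mul_neg,
        neg_neg, mul_assoc]
    rw [e, ← two_smul ℝ, centerForm_single] at h1
    have h2 := congrArg (· * M.J (Pi.single c 1)) h1
    simp only [smul_mul_assoc, mul_assoc, hCC, one_mul, mul_smul_comm, mul_one] at h2
    have hs := centerSign_mul_self c
    rw [map_smul]
    have h3 := congrArg (fun f => (-(centerSign c : ℝ) / 2) • f) h2
    simp only [smul_smul] at h3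
    convert h3 using 1
    · rw [show -(centerSign c : ℝ) / 2 * (2 * -centerSign c) = 1 by linarith, one_smul]
    · congr 1
      linear_combination (-U c) * hs
  have hU0 : U ≠ 0 := by
    rintro rfl
    rw [map_zero, eq_comm, smul_eq_zero_iff_right two_ne_zero] at hU
    rw [hU, mul_zero, eq_comm, neg_smul, neg_eq_zero,
      smul_eq_zero_iff_right (centerSign_ne_zero a)] at hAAB
    rw [hAAB, mul_zero, eq_comm, neg_smul, neg_eq_zero,
      smul_eq_zero_iff_right (centerSign_ne_zero b)] at hB
    exact one_ne_zero hB
  obtain ⟨c, hc⟩ := Function.ne_iff.1 hU0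
  have hca : c ≠ a := by rintro rfl; exact hc hUa
  have hcb : c ≠ b := by rintro rfl; exact hc hUb
  refine ⟨c, hca, hcb, fun d => ?_, ?_⟩
  -- With a fourth index `d`, `U` would also be a multiple of `e_d`, contradicting `U c ≠ 0`.
  · by_contra! hd
    apply hc
    rw [hUc d hd.1 hd.2.1]
    simp [Pi.single_eq_of_ne hd.2.2.symm]
  -- Compare `J_U² = 4(AB)² = -4 ε_a ε_b` with `J_U² = -U_c² ε_c`.
  · have h1 := M.J_mul_self U
    rw [hU, smul_mul_assoc, mul_smul_comm, ← mul_assoc, hABA, smul_mul_assoc, hB] at h1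
    have h2 : centerForm r s U U = U c * U c * centerSign c := by
      conv_lhs => rw [hUc c hca hcb]
      simp [centerForm_single, mul_assoc]
    simp only [h2, smul_smul] at h1
    have h3 := smul_left_injective ℝ (one_ne_zero (α := Module.End ℝ V)) h1
    have hs := centerSign_mul_self c
    have hpos : 0 < U c * U c := mul_self_pos.2 hc
    have : (centerSign a * centerSign b * centerSign c : ℝ) = U c * U c / 4 := by
      linear_combination (-centerSign c / 4) * h3 + U c * U c / 4 * hs
    rw [this]
    positivity

theorem prod_centerSign : ∏ k : Fin r ⊕ Fin s, (centerSign k : ℝ) = (-1) ^ s := by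
  simp [Fintype.prod_sum_type, centerSign]

theorem IsLieClosed.mem [Nontrivial V] {M : AdmissibleModule r s V} (h : M.IsLieClosed)
    (hrs : 1 ≤ r + s) : (r, s) ∈ ({(1, 0), (0, 1), (3, 0), (1, 2)} : Set (ℕ × ℕ)) := by
  have hcard : Fintype.card (Fin r ⊕ Fin s) = r + s := by simp
  simp only [Set.mem_insert_iff, Set.mem_singleton_iff, Prod.mk.injEq]
  rcases hrs.eq_or_lt with h1 | h1
  · omega
  · obtain ⟨a, b, hab⟩ := Fintype.one_lt_card_iff.1 (hcard ▸ h1)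
    obtain ⟨c, hca, hcb, hc, hpos⟩ := h.exists_third hab
    have huniv : (Finset.univ : Finset (Fin r ⊕ Fin s)) = {a, b, c} := by
      ext d; simpa using hc d
    have h3 : r + s = 3 := by
      rw [← hcard, ← Finset.card_univ, huniv, Finset.card_eq_three]
      exact ⟨a, b, c, hab, hca.symm, hcb.symm, rfl⟩
    have hp := prod_centerSign (r := r) (s := s)
    rw [huniv, Finset.prod_insert (by simp [hab, hca.symm]), Finset.prod_pair hcb.symm,
      ← mul_assoc] at hp
    rw [hp] at hpos
    have : s ≤ 3 := by omega
    -- In rank three, positivity of `(-1)^s` excludes `s = 1` and `s = 3`.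
    interval_cases s
    · omega
    · norm_num at hpos
    · omega
    · norm_num at hpos

/-! ### Minimality and the volume element -/

/-- The restriction of an admissible module to an invariant nondegenerate subspace. -/
def restrict (p : Submodule ℝ V) (hp : ∀ Z, ∀ X ∈ p, M.J Z X ∈ p)
    (hn : ∀ X ∈ p, (∀ Y ∈ p, M.form X Y = 0) → X = 0) : AdmissibleModule r s p :=
  let f : (Fin r ⊕ Fin s → ℝ) →ₗ[ℝ] Module.End ℝ p :=
    { toFun := fun Z => (M.J Z).restrict (hp Z)
      map_add' := fun Z W => by ext; simp
      map_smul' := fun c Z => by ext; simp }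
  have hf : ∀ Z, f Z * f Z = algebraMap ℝ _ (cliffordForm r s Z) := fun Z => by
    ext X
    exact M.J_J Z X
  have hι : ∀ Z X, (CliffordAlgebra.lift (cliffordForm r s) ⟨f, hf⟩
      (CliffordAlgebra.ι (cliffordForm r s) Z) X : V) = M.J Z X := fun Z X => by
    rw [CliffordAlgebra.lift_ι_apply]; rfl
  { rep := CliffordAlgebra.lift (cliffordForm r s) ⟨f, hf⟩
    form := M.form.restrict p
    form_symm := fun X Y => M.form_symm X Y
    form_nondegenerate := by
      refine ⟨fun X hX => ?_, fun X hX => ?_⟩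
      · exact Subtype.ext (hn X X.2 fun Y hY => hX ⟨Y, hY⟩)
      · exact Subtype.ext (hn X X.2 fun Y hY => (M.form_symm _ _).trans (hX ⟨Y, hY⟩))
    form_skew := fun Z X Y => by
      simp only [LinearMap.BilinForm.restrict_apply, LinearMap.domRestrict_apply, hι]
      exact M.form_J Z X Y }

/-- A self-adjoint involution commuting with the Clifford action of a minimal admissible module
is `1` or `-1`. -/
theorem IsMinimal.eq_one_or_eq_neg_one [FiniteDimensional ℝ V] {M : AdmissibleModule r s V}
    (hM : M.IsMinimal) (Ω : Module.End ℝ V) (hsq : Ω * Ω = 1)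
    (hcomm : ∀ Z, Ω * M.J Z = M.J Z * Ω) (hadj : ∀ X Y, M.form (Ω X) Y = M.form X (Ω Y)) :
    Ω = 1 ∨ Ω = -1 := by
  have hΩ : ∀ X, Ω (Ω X) = X := fun X => LinearMap.congr_fun hsq X
  let p : Submodule ℝ V := LinearMap.ker (Ω - 1)
  have hp : ∀ X, X ∈ p ↔ Ω X = X := fun X => by
    rw [LinearMap.mem_ker, LinearMap.sub_apply, Module.End.one_apply, sub_eq_zero]
  -- `X + ΩX` is twice the projection of `X` to the `+1`-eigenspace.
  have hadd : ∀ X, X + Ω X ∈ p := fun X => by rw [hp, map_add, hΩ, add_comm]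
  by_cases hbot : p = ⊥
  · right
    ext X
    have h := hadd X
    rw [hbot, Submodule.mem_bot] at h
    exact eq_neg_of_add_eq_zero_right h
  · left
    have : Nontrivial p := Submodule.nontrivial_iff_ne_bot.2 hbot
    have h := hM p (M.restrict p
      (fun Z X hX => by
        rw [hp] at hX ⊢
        have := LinearMap.congr_fun (hcomm Z) X
        simp only [Module.End.mul_apply, hX] at this
        exact this)
      -- Nondegeneracy on `p`: for `X ∈ p`, self-adjointness gives `⟨X, Y + ΩY⟩ = 2⟨X, Y⟩`.
      (fun X hX h => M.eq_zero_of_form fun Y => by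
        have h1 := h _ (hadd Y)
        rw [map_add, ← hadj, (hp X).1 hX] at h1
        linarith))
    have htop := Submodule.eq_top_of_finrank_eq (le_antisymm p.finrank_le h)
    ext X
    exact (hp X).1 (htop ▸ Submodule.mem_top)

/-- Commutators are bilinear and vanish on the diagonal, so products of distinct basis operators
suffice. -/
theorem isLieClosed_of_single (h : ∀ k l : Fin r ⊕ Fin s, k ≠ l →
    M.J (Pi.single k 1) * M.J (Pi.single l 1) ∈ LinearMap.range M.J) : M.IsLieClosed := by
  have hb : ∀ k l, M.J (Pi.single k 1) * M.J (Pi.single l 1)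
      - M.J (Pi.single l 1) * M.J (Pi.single k 1) ∈ LinearMap.range M.J := fun k l => by
    by_cases hkl : k = l
    · rw [hkl, sub_self]; exact zero_mem _
    · exact sub_mem (h k l hkl) (h l k (Ne.symm hkl))
  have hsum : ∀ Z, M.J Z = ∑ k, Z k • M.J (Pi.single k 1) := fun Z => by
    conv_lhs => rw [pi_eq_sum_univ' Z]
    simp only [map_sum, map_smul]
  intro Z W
  have e : M.J Z * M.J W - M.J W * M.J Z = ∑ k, ∑ l, (Z k * W l) •
      (M.J (Pi.single k 1) * M.J (Pi.single l 1) - M.J (Pi.single l 1) * M.J (Pi.single k 1)) := by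
    simp only [smul_sub, Finset.sum_sub_distrib]
    congr 1
    · rw [hsum Z, hsum W, Finset.sum_mul_sum]
      simp only [smul_mul_smul_comm]
    · rw [hsum Z, hsum W, Finset.sum_mul_sum, Finset.sum_comm]
      simp only [smul_mul_smul_comm, mul_comm]
  rw [e]
  exact sum_mem fun k _ => sum_mem fun l _ => Submodule.smul_mem _ _ (hb k l)

/-- In rank three with positive product of signs, the volume element of a minimal admissible
module is `1` or `-1`. -/
theorem IsMinimal.volume_eq [FiniteDimensional ℝ V] {M : AdmissibleModule r s V}
    (hM : M.IsMinimal) {a b c : Fin r ⊕ Fin s} (hab : a ≠ b) (hac : a ≠ c) (hbc : b ≠ c)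
    (hall : ∀ d, d = a ∨ d = b ∨ d = c)
    (hs : (centerSign a * centerSign b * centerSign c : ℝ) = 1) :
    M.J (Pi.single a 1) * M.J (Pi.single b 1) * M.J (Pi.single c 1) = 1 ∨
      M.J (Pi.single a 1) * M.J (Pi.single b 1) * M.J (Pi.single c 1) = -1 := by
  have fA := M.form_J (Pi.single a 1)
  have fB := M.form_J (Pi.single b 1)
  have fC := M.form_J (Pi.single c 1)
  have hsum : ∀ Z, M.J Z = Z a • M.J (Pi.single a 1) + Z b • M.J (Pi.single b 1)
      + Z c • M.J (Pi.single c 1) := fun Z => by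
    have huniv : (Finset.univ : Finset (Fin r ⊕ Fin s)) = {a, b, c} := by
      ext d; simpa using hall d
    conv_lhs => rw [pi_eq_sum_univ' Z, huniv, Finset.sum_insert (by simp [hab, hac]),
      Finset.sum_pair hbc]
    simp only [map_add, map_smul, add_assoc]
  have hAA := M.J_single_mul_self a
  have hBB := M.J_single_mul_self b
  have hCC := M.J_single_mul_self c
  have hBA := M.J_single_mul_comm hab
  have hCA := M.J_single_mul_comm hac
  have hCB := M.J_single_mul_comm hbc
  generalize M.J (Pi.single a 1) = A at *
  generalize M.J (Pi.single b 1) = B at *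
  generalize M.J (Pi.single c 1) = C at *
  have hBA' : ∀ X, B * (A * X) = -(A * (B * X)) := fun X => by
    rw [← mul_assoc, hBA, neg_mul, mul_assoc]
  have hCA' : ∀ X, C * (A * X) = -(A * (C * X)) := fun X => by
    rw [← mul_assoc, hCA, neg_mul, mul_assoc]
  have hCB' : ∀ X, C * (B * X) = -(B * (C * X)) := fun X => by
    rw [← mul_assoc, hCB, neg_mul, mul_assoc]
  have hAA' : ∀ X, A * (A * X) = -centerSign a • X := fun X => by
    rw [← mul_assoc, hAA, smul_mul_assoc, one_mul]
  have hBB' : ∀ X, B * (B * X) = -centerSign b • X := fun X => by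
    rw [← mul_assoc, hBB, smul_mul_assoc, one_mul]
  -- `Ω = ABC` has `Ω² = -A²B²C² = ε_a ε_b ε_c = 1`, is central because the rank is odd, and is
  -- self-adjoint because its adjoint is `-CBA = ABC`.
  refine hM.eq_one_or_eq_neg_one _ ?_ (fun Z => ?_) fun X Y => ?_
  · simp only [mul_assoc, hBA', hCA', hCB', hCC, mul_neg, neg_neg, mul_smul_comm,
      mul_one, smul_smul, hBB, hAA]
    rw [← neg_smul, smul_smul, show (-centerSign c * -(-(-centerSign b * centerSign a)) : ℝ) = 1 by
      linear_combination hs, one_smul]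
  · rw [hsum]
    simp only [mul_assoc, mul_add, add_mul, smul_mul_assoc, mul_smul_comm, hBA', hCA', hCB', hAA',
      hBB', hCA, hCB, hCC, mul_neg, neg_neg, smul_neg, mul_one]
  · simp only [Module.End.mul_apply, fA, fB, fC, neg_neg]
    have e : C (B (A Y)) = -(A (B (C Y))) := by
      have : C * (B * A) = -(A * (B * C)) := by
        simp only [hBA, hCA', hCB, mul_neg, neg_neg]
      exact LinearMap.congr_fun this Y
    rw [e, map_neg, neg_neg]

theorem IsMinimal.isLieClosed [FiniteDimensional ℝ V] {M : AdmissibleModule r s V}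
    (hM : M.IsMinimal) (hrs : r + s = 3) (hs : Even s) : M.IsLieClosed := by
  refine M.isLieClosed_of_single fun k l hkl => ?_
  have hcard : Fintype.card (Fin r ⊕ Fin s) = 3 := by simp [hrs]
  obtain ⟨m, hm⟩ : ∃ m, m ∉ ({k, l} : Finset (Fin r ⊕ Fin s)) := by
    by_contra! h
    have := Finset.card_le_card (fun d _ => h d : Finset.univ ⊆ _)
    rw [Finset.card_univ, hcard, Finset.card_pair hkl] at this
    omega
  obtain ⟨hmk, hml⟩ : m ≠ k ∧ m ≠ l := by simpa using hm
  have huniv : ({k, l, m} : Finset (Fin r ⊕ Fin s)) = Finset.univ := by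
    rw [← Finset.card_eq_iff_eq_univ, hcard, Finset.card_eq_three]
    exact ⟨k, l, m, hkl, hmk.symm, hml.symm, rfl⟩
  have hp := prod_centerSign (r := r) (s := s)
  rw [← huniv, Finset.prod_insert (by simp [hkl, hmk.symm]), Finset.prod_pair hml.symm,
    ← mul_assoc, hs.neg_one_pow] at hp
  have hv := hM.volume_eq hkl hmk.symm hml.symm
    (fun d => by have := Finset.mem_univ d; rw [← huniv] at this; simpa using this) hp
  -- From `J_m² = -ε_m` one gets `J_k J_l = -ε_m Ω J_m`, and `Ω = ±1`.
  have h1 : M.J (Pi.single k 1) * M.J (Pi.single l 1) = -(centerSign m : ℝ) •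
      (M.J (Pi.single k 1) * M.J (Pi.single l 1) * M.J (Pi.single m 1) * M.J (Pi.single m 1)) := by
    rw [mul_assoc _ (M.J (Pi.single m 1)), J_single_mul_self, mul_smul_comm, mul_one, smul_smul,
      neg_mul_neg, centerSign_mul_self, one_smul]
  rw [h1]
  refine Submodule.smul_mem _ _ ?_
  rcases hv with hv | hv <;> rw [hv]
  · exact ⟨_, (one_mul _).symm⟩
  · rw [neg_one_mul]
    exact neg_mem ⟨_, rfl⟩

theorem isLieClosed_of_rank_one (hrs : r + s = 1) : M.IsLieClosed := by
  have : Subsingleton (Fin r ⊕ Fin s) :=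
    Fintype.card_le_one_iff_subsingleton.1 (by simp [hrs])
  exact M.isLieClosed_of_single fun k l hkl => absurd (Subsingleton.elim k l) hkl

theorem isNaturallyReductive_iff_isLieClosed [Nontrivial V] [Nonempty (Fin r ⊕ Fin s)] :
    M.IsNaturallyReductive ↔ M.IsLieClosed :=
  ⟨IsNaturallyReductive.isLieClosed M, IsLieClosed.isNaturallyReductive⟩

end AdmissibleModule

theorem proposition4p1 {r s : ℕ} (hrs : 1 ≤ r + s)
    {V : Type*} [AddCommGroup V] [Module ℝ V] [FiniteDimensional ℝ V] [Nontrivial V]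
    (M : AdmissibleModule r s V) (hM : M.IsMinimal ∨ (r, s) = (0, 1)) :
    M.IsNaturallyReductive ↔
      (r, s) ∈ ({(1, 0), (0, 1), (3, 0), (1, 2)} : Set (ℕ × ℕ)) := by
  have : Nonempty (Fin r ⊕ Fin s) := Fintype.card_pos_iff.1 (by simp; omega)
  rw [M.isNaturallyReductive_iff_isLieClosed]
  refine ⟨fun h => h.mem hrs, fun h => ?_⟩
  simp only [Set.mem_insert_iff, Set.mem_singleton_iff, Prod.mk.injEq] at h hM
  -- Rank one needs no minimality, as all `J_Z` are proportional; this covers the arbitrary modules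
  -- allowed for `(0, 1)`.
  by_cases h1 : r + s = 1
  · exact M.isLieClosed_of_rank_one h1
  · rcases hM with hM | hM
    · exact hM.isLieClosed (by omega) (by rw [Nat.even_iff]; omega)
    · omega
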